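/- Let $q$ be a prime power with $q \equiv 1 \pmod 4$, and let $\zeta$ be a primitive element of the field $\mathbb{F}_q$, that is, a generator of its multiplicative group (equivalently, a primitive $(q-1)$-th root of unity). The SlimFly graph $\mathrm{SF}(q)$ is the simple graph with vertex set $\{0,1\}\times\mathbb{F}_q\times\mathbb{F}_q$ whose edges are 1. $\{(0,x,y),(0,x,y')\}$, where $y-y'=\zeta^i$ for some even $i$; 2. $\{(1,m,c),(1,m,c')\}$, where $c-c'=\zeta^j$ for some odd $j$; 3. $\{(0,x,y),(1,m,c)\}$, where $y=mx+c$. The bisection bandwidth $\mathrm{BW}(G)$ of a finite graph $G$ is the minimum number of edges of $G$ crossing a balanced bipartition of its vertices, i.e. a partition into two parts whose sizes differ by at most one. Then, for every choice of $\zeta$, \[ \frac{q^3}{2} \;\le\; \mathrm{BW}(\mathrm{SF}(q)) \;\le\; \frac{q(q^2+1)}{2}. \] -/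

import Mathlib

/-- The edges of `G` with one endpoint in `S` and the other outside `S`. -/
def SimpleGraph.crossingEdges {V : Type*} (G : SimpleGraph V) (S : Set V) : Set (Sym2 V) :=
  {e | ∃ u ∈ S, ∃ v ∈ Sᶜ, G.Adj u v ∧ e = s(u, v)}

/-- The bipartition `(S, Sᶜ)` of the vertices is balanced: the sizes of its parts differ by at
most one (so they are equal if the number of vertices is even). -/
def IsBalancedSet {V : Type*} (S : Set V) : Prop :=
  S.ncard ≤ Sᶜ.ncard + 1 ∧ Sᶜ.ncard ≤ S.ncard + 1

/-- The bisection bandwidth of a finite graph: the minimum number of edges crossing a balanced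
bipartition of the vertices. -/
noncomputable def SimpleGraph.bisectionBandwidth {V : Type*} [Finite V] (G : SimpleGraph V) : ℕ :=
  sInf {k | ∃ S : Set V, IsBalancedSet S ∧ (G.crossingEdges S).ncard = k}

theorem exists_isBalancedSet (V : Type*) [Finite V] : ∃ S : Set V, IsBalancedSet S := by
  obtain ⟨S, -, hS⟩ := Set.exists_subset_card_eq (s := (Set.univ : Set V)) (n := Nat.card V / 2)
    (by rw [Set.ncard_univ]; omega)
  have h := Set.ncard_add_ncard_compl S
  refine ⟨S, ?_, ?_⟩ <;> omega

/-- The infimum defining the bisection bandwidth is attained. -/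
theorem SimpleGraph.isLeast_bisectionBandwidth {V : Type*} [Finite V] (G : SimpleGraph V) :
    IsLeast {k | ∃ S : Set V, IsBalancedSet S ∧ (G.crossingEdges S).ncard = k}
      G.bisectionBandwidth := by
  obtain ⟨S, hS⟩ := exists_isBalancedSet V
  exact ⟨Nat.sInf_mem ⟨_, S, hS, rfl⟩, fun _ hk => Nat.sInf_le hk⟩

/-- The SlimFly graph on `{0, 1} × F × F` for a primitive element `ζ` of the finite field `F`.
Its edges are the unordered pairs
* `{(0, x, y), (0, x, y')}` with `y - y'` an even power of `ζ`,
* `{(1, m, c), (1, m, c')}` with `c - c'` an odd power of `ζ`,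
* `{(0, x, y), (1, m, c)}` with `y = m * x + c`. -/
def slimFly {F : Type*} [Field F] (ζ : F) : SimpleGraph (Fin 2 × F × F) :=
  SimpleGraph.fromRel fun u v =>
    (∃ x y y' : F, u = (0, x, y) ∧ v = (0, x, y') ∧ ∃ i : ℕ, Even i ∧ y - y' = ζ ^ i) ∨
    (∃ m c c' : F, u = (1, m, c) ∧ v = (1, m, c') ∧ ∃ j : ℕ, Odd j ∧ c - c' = ζ ^ j) ∨
    (∃ x y m c : F, u = (0, x, y) ∧ v = (1, m, c) ∧ y = m * x + c)

/-! Call the sets with fixed first field coordinate columns. Let `f`, `g` be the 0/1 indicators of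
one side of a balanced cut on points and lines, with totals A + B = q². Let C be convolution with
the quadratic character χ in each column, and L the sum over the lines through a point. Adjacency
inside a column is (1 - δ ± χ)/2, so the cut is an explicit quadratic expression in `f`, `g`
(`ncard_crossingEdges_slimFly`).

Let `f'`, `g'` be `f`, `g` minus their column means. The cut equals q³ - 2AB/q plus (q/2)(‖f'‖² +
‖g'‖²) minus the form of M = [[C/2, L], [Lᵀ, -C/2]] at (f', g'). On functions with zero column sums,
C² = LLᵀ = LᵀL = q, and C commutes with line sums, so M² = 5q/4. Its norm √(5q)/2 is at most q/2
because q ≥ 5; this is the content of `quadraticForm_le`. Hence the cut is at least q³ - 2AB/q ≥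
q³/2.

For the upper bound, a cut made of whole columns severs only point-line edges, which can be counted
exactly. -/

/-! ### Quadratic character: correlations and convolution. -/

section QuadraticCharacterSums

variable {F : Type*} [Field F] [Fintype F]

open Classical in
/-- The quadratic character of a finite field with real values. -/
noncomputable def realQuadraticChar (F : Type*) [Field F] [Fintype F] (z : F) : ℝ :=
  ((quadraticChar F z : ℤ) : ℝ)

local notation "χ" => realQuadraticChar F

theorem realQuadraticChar_zero : χ 0 = 0 := by
  simp [realQuadraticChar]

theorem realQuadraticChar_mul (a b : F) : χ (a * b) = χ a * χ b := by
  classical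
  simp only [realQuadraticChar]
  rw [map_mul, Int.cast_mul]

theorem realQuadraticChar_mul_self {a : F} (ha : a ≠ 0) : χ a * χ a = 1 := by
  classical
  have h := quadraticChar_sq_one (F := F) ha
  rw [sq] at h
  simp only [realQuadraticChar]
  exact_mod_cast h

theorem realQuadraticChar_neg (hF : Fintype.card F % 4 = 1) (a : F) : χ (-a) = χ a := by
  classical
  have h : IsSquare (-1 : F) := FiniteField.isSquare_neg_one_iff.2 (by omega)
  have h1 : χ (-1) = 1 := by
    simp only [realQuadraticChar]
    rw [(quadraticChar_one_iff_isSquare (neg_ne_zero.2 one_ne_zero)).2 h]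
    simp
  rw [← neg_one_mul, realQuadraticChar_mul, h1, one_mul]

theorem ringChar_ne_two_of_card_mod_four (hF : Fintype.card F % 4 = 1) : ringChar F ≠ 2 := by
  intro h
  have := FiniteField.even_card_of_char_two h
  omega

theorem sum_realQuadraticChar (hF : Fintype.card F % 4 = 1) : ∑ z, χ z = 0 := by
  classical
  have h := quadraticChar_sum_zero (ringChar_ne_two_of_card_mod_four hF)
  simp only [realQuadraticChar]
  exact_mod_cast h

theorem sum_realQuadraticChar_sub (hF : Fintype.card F % 4 = 1) (a : F) :
    ∑ z, χ (z - a) = 0 := by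
  rw [← sum_realQuadraticChar hF]
  exact (Equiv.subRight a).sum_comp (realQuadraticChar F)

theorem sum_realQuadraticChar_sub' (hF : Fintype.card F % 4 = 1) (a : F) :
    ∑ z, χ (a - z) = 0 := by
  rw [← sum_realQuadraticChar hF]
  exact (Equiv.subLeft a).sum_comp (realQuadraticChar F)

theorem sum_realQuadraticChar_mul_self :
    ∑ z, χ z * χ z = (Fintype.card F : ℝ) - 1 := by
  classical
  rw [← Finset.sum_erase_add _ _ (Finset.mem_univ (0 : F)), realQuadraticChar_zero,
    Finset.sum_congr rfl fun z hz => realQuadraticChar_mul_self (Finset.ne_of_mem_erase hz)]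
  rw [Finset.sum_const, Finset.card_erase_of_mem (Finset.mem_univ _), Finset.card_univ,
    nsmul_eq_mul, Nat.cast_sub Fintype.card_pos]
  simp

theorem sum_realQuadraticChar_mul_add (hF : Fintype.card F % 4 = 1) {a : F} (ha : a ≠ 0) :
    ∑ z, χ z * χ (z + a) = -1 := by
  classical
  have h1 : ∑ z ∈ Finset.univ.erase (0 : F), χ z * χ (z + a)
      = ∑ w ∈ Finset.univ.erase (1 : F), χ w := by
    -- χ(z)χ(z + a) = χ(z)²χ(1 + a/z) for z ≠ 0, and 1 + a/z takes every value except 1.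
    refine Finset.sum_bij' (fun z _ => 1 + a / z) (fun w _ => a / (w - 1)) ?_ ?_ ?_ ?_ ?_
    · intro z hz
      have := Finset.ne_of_mem_erase hz
      simp [ha, this]
    · intro w hw
      have := Finset.ne_of_mem_erase hw
      simp [ha, sub_ne_zero.2 this]
    · intro z hz
      have := Finset.ne_of_mem_erase hz
      simp only [add_sub_cancel_left]
      field_simp
    · intro w hw
      have := sub_ne_zero.2 (Finset.ne_of_mem_erase hw)
      field_simp
      ring
    · intro z hz
      have hz := Finset.ne_of_mem_erase hz
      have : z + a = z * (1 + a / z) := by field_simp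
      rw [this, realQuadraticChar_mul, ← mul_assoc, realQuadraticChar_mul_self hz, one_mul]
  have h2 : χ 1 = 1 := by simp [realQuadraticChar]
  have h3 := sum_realQuadraticChar hF
  rw [← Finset.sum_erase_add _ _ (Finset.mem_univ (1 : F)), h2] at h3
  rw [← Finset.sum_erase_add _ _ (Finset.mem_univ (0 : F)), h1, realQuadraticChar_zero]
  linarith

theorem sum_realQuadraticChar_sub_mul_sub [DecidableEq F] (hF : Fintype.card F % 4 = 1)
    (a b : F) :
    ∑ z, χ (z - a) * χ (z - b) = (if a = b then (Fintype.card F : ℝ) else 0) - 1 := by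
  rw [← Equiv.sum_comp (Equiv.addRight a)]
  simp only [Equiv.coe_addRight, add_sub_cancel_right, add_sub_assoc]
  split_ifs with h
  · subst h
    simp [sum_realQuadraticChar_mul_self]
  · rw [sum_realQuadraticChar_mul_add hF (sub_ne_zero.2 h), zero_sub]

/-- Convolution of a function with the quadratic character. -/
noncomputable def quadraticConv (g : F → ℝ) (y : F) : ℝ := ∑ y', χ (y - y') * g y'

/-- Translates of χ have correlation qδ - 1, and the -1 dies against functions of sum zero: C² = q
there. -/
theorem sum_quadraticConv_sq (hF : Fintype.card F % 4 = 1) {g : F → ℝ} (hg : ∑ y, g y = 0) :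
    ∑ y, quadraticConv g y ^ 2 = (Fintype.card F : ℝ) * ∑ y, g y ^ 2 := by
  classical
  calc ∑ y, quadraticConv g y ^ 2
      = ∑ y, ∑ a, ∑ b, g a * g b * (χ (y - a) * χ (y - b)) := by
        simp only [quadraticConv, sq, Finset.sum_mul_sum]
        exact Finset.sum_congr rfl fun y _ => Finset.sum_congr rfl fun a _ =>
          Finset.sum_congr rfl fun b _ => by ring
    _ = ∑ a, ∑ b, g a * g b * ∑ y, χ (y - a) * χ (y - b) := by
        rw [Finset.sum_comm]
        refine Finset.sum_congr rfl fun a _ => ?_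
        rw [Finset.sum_comm]
        simp only [Finset.mul_sum]
    _ = ∑ a, (Fintype.card F * g a ^ 2 - g a * ∑ b, g b) := by
        refine Finset.sum_congr rfl fun a _ => ?_
        simp only [sum_realQuadraticChar_sub_mul_sub hF, mul_sub, mul_ite, mul_zero, mul_one,
          Finset.sum_sub_distrib, Finset.sum_ite_eq, Finset.mem_univ, if_true, Finset.mul_sum]
        ring
    _ = _ := by simp [hg, Finset.mul_sum]

theorem quadraticConv_add_const (hF : Fintype.card F % 4 = 1) (g : F → ℝ) (a : ℝ) (y : F) :
    quadraticConv (fun z => g z + a) y = quadraticConv g y := by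
  simp only [quadraticConv, mul_add, Finset.sum_add_distrib, ← Finset.sum_mul,
    sum_realQuadraticChar_sub' hF, zero_mul, add_zero]

theorem sum_quadraticConv (hF : Fintype.card F % 4 = 1) (g : F → ℝ) :
    ∑ y, quadraticConv g y = 0 := by
  simp only [quadraticConv]
  rw [Finset.sum_comm]
  simp [← Finset.sum_mul, sum_realQuadraticChar_sub hF]

end QuadraticCharacterSums

/-! ### Incidence sums and the spectral estimate. -/

section LineSums

variable {F : Type*} [Field F] [Fintype F]

/-- The sum of `g (m, c)` over the lines `y = m * x + c` through the point `(x, y)`. -/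
def sumLinesThrough (g : F → F → ℝ) (x y : F) : ℝ := ∑ m, g m (y - m * x)

/-- The sum of `f (x, y)` over the points of the line `y = m * x + c`. -/
def sumPointsOn (f : F → F → ℝ) (m c : F) : ℝ := ∑ x, f x (m * x + c)

theorem sum_mul_sumLinesThrough (f g : F → F → ℝ) :
    ∑ x, ∑ y, f x y * sumLinesThrough g x y = ∑ m, ∑ c, sumPointsOn f m c * g m c := by
  simp only [sumLinesThrough, sumPointsOn, Finset.mul_sum, Finset.sum_mul]
  calc ∑ x, ∑ y, ∑ m, f x y * g m (y - m * x)
      = ∑ x, ∑ m, ∑ c, f x (m * x + c) * g m c := by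
        refine Finset.sum_congr rfl fun x _ => ?_
        rw [Finset.sum_comm]
        refine Finset.sum_congr rfl fun m _ => ?_
        rw [← Equiv.sum_comp (Equiv.addLeft (m * x))]
        simp
    _ = ∑ m, ∑ c, ∑ x, f x (m * x + c) * g m c := by
        rw [Finset.sum_comm]
        exact Finset.sum_congr rfl fun m _ => Finset.sum_comm

/-- Expanding the square, two distinct slopes contribute nothing: with the first intercept fixed,
the second runs over all of F as x varies, and the column sum vanishes. -/
theorem sum_sumLinesThrough_sq {g : F → F → ℝ} (hg : ∀ m, ∑ c, g m c = 0) :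
    ∑ x, ∑ y, sumLinesThrough g x y ^ 2 = (Fintype.card F : ℝ) * ∑ m, ∑ c, g m c ^ 2 := by
  classical
  have key : ∀ m m' : F, ∑ x, ∑ y, g m (y - m * x) * g m' (y - m' * x)
      = if m = m' then (Fintype.card F : ℝ) * ∑ c, g m c ^ 2 else 0 := by
    intro m m'
    have h : ∀ x, ∑ y, g m (y - m * x) * g m' (y - m' * x)
        = ∑ c, g m c * g m' ((m - m') * x + c) := by
      intro x
      rw [← Equiv.sum_comp (Equiv.addRight (m * x))]
      refine Finset.sum_congr rfl fun c _ => ?_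
      simp only [Equiv.coe_addRight, add_sub_cancel_right]
      congr 2
      ring
    simp only [h]
    split_ifs with hm
    · subst hm
      simp [sq]
    · rw [Finset.sum_comm]
      refine Finset.sum_eq_zero fun c _ => ?_
      rw [← Finset.mul_sum]
      have := ((Equiv.mulLeft₀ (m - m') (sub_ne_zero.2 hm)).trans
        (Equiv.addRight c)).sum_comp (g m')
      simp only [Equiv.trans_apply, Equiv.mulLeft₀_apply, Equiv.coe_addRight] at this
      rw [this, hg, mul_zero]
  calc ∑ x, ∑ y, sumLinesThrough g x y ^ 2
      = ∑ x, ∑ m, ∑ m', ∑ y, g m (y - m * x) * g m' (y - m' * x) := by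
        simp only [sumLinesThrough, sq, Finset.sum_mul_sum]
        refine Finset.sum_congr rfl fun x _ => ?_
        rw [Finset.sum_comm]
        exact Finset.sum_congr rfl fun m _ => Finset.sum_comm
    _ = ∑ m, ∑ m', ∑ x, ∑ y, g m (y - m * x) * g m' (y - m' * x) := by
        rw [Finset.sum_comm]
        exact Finset.sum_congr rfl fun m _ => Finset.sum_comm
    _ = _ := by simp [key, Finset.mul_sum]

theorem sum_sumPointsOn_sq {f : F → F → ℝ} (hf : ∀ x, ∑ y, f x y = 0) :
    ∑ m, ∑ c, sumPointsOn f m c ^ 2 = (Fintype.card F : ℝ) * ∑ x, ∑ y, f x y ^ 2 := by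
  -- Point-line duality: replacing m by -m turns y = mx + c into c = y + mx, so sums over points
  -- become sums over lines.
  rw [← sum_sumLinesThrough_sq hf, ← Equiv.sum_comp (Equiv.neg F)]
  refine Finset.sum_congr rfl fun m _ => Finset.sum_congr rfl fun c _ => ?_
  simp only [sumPointsOn, sumLinesThrough, Equiv.neg_apply]
  congr 1
  refine Finset.sum_congr rfl fun x _ => ?_
  congr 1
  ring

/-- Line sums intertwine the convolutions with the quadratic character. -/
theorem sum_quadraticConv_mul_sumLinesThrough (hF : Fintype.card F % 4 = 1) (f g : F → F → ℝ) :
    ∑ x, ∑ y, quadraticConv (f x) y * sumLinesThrough g x y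
      = ∑ m, ∑ c, sumPointsOn f m c * quadraticConv (g m) c := by
  rw [sum_mul_sumLinesThrough (fun x y => quadraticConv (f x) y)]
  simp only [sumPointsOn, Finset.sum_mul]
  refine Finset.sum_congr rfl fun m _ => ?_
  rw [Finset.sum_comm]
  conv_rhs => rw [Finset.sum_comm]
  refine Finset.sum_congr rfl fun x _ => ?_
  -- Convolution commutes with the translation by m * x; what remains is the symmetry of the kernel,
  -- that is, χ(-1) = 1.
  have h : ∀ c, quadraticConv (f x) (m * x + c)
      = ∑ c', realQuadraticChar F (c - c') * f x (m * x + c') := by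
    intro c
    rw [quadraticConv, ← Equiv.sum_comp (Equiv.addLeft (m * x))]
    simp
  simp only [h]
  simp only [quadraticConv, Finset.sum_mul, Finset.mul_sum]
  rw [Finset.sum_comm]
  refine Finset.sum_congr rfl fun c _ => Finset.sum_congr rfl fun c' _ => ?_
  rw [← neg_sub c c', realQuadraticChar_neg hF]
  ring

/-- A column-constant function has constant line sums, so it is orthogonal to the centred parts and
the cross terms vanish. -/
theorem sum_mul_sumLinesThrough_add_const (f g : F → F → ℝ) (a b : F → ℝ)
    (hf : ∀ x, ∑ y, f x y = 0) (hg : ∀ m, ∑ c, g m c = 0) :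
    ∑ x, ∑ y, (f x y + a x) * sumLinesThrough (fun m c => g m c + b m) x y
      = ∑ x, ∑ y, f x y * sumLinesThrough g x y
        + (Fintype.card F : ℝ) * (∑ x, a x) * ∑ m, b m := by
  have h1 : ∀ x y, sumLinesThrough (fun m c => g m c + b m) x y
      = sumLinesThrough g x y + ∑ m, b m := by
    intro x y
    simp [sumLinesThrough, Finset.sum_add_distrib]
  have h2 : ∀ x, ∑ y, sumLinesThrough g x y = 0 := by
    intro x
    simp only [sumLinesThrough]
    rw [Finset.sum_comm]
    refine Finset.sum_eq_zero fun m _ => ?_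
    rw [← hg m]
    exact (Equiv.subRight (m * x)).sum_comp (g m)
  have h3 : ∀ x, ∑ y, (f x y + a x) * sumLinesThrough (fun m c => g m c + b m) x y
      = ∑ y, f x y * sumLinesThrough g x y + (Fintype.card F : ℝ) * a x * ∑ m, b m := by
    intro x
    simp only [h1, add_mul, mul_add, Finset.sum_add_distrib, ← Finset.sum_mul, ← Finset.mul_sum,
      h2, hf, Finset.sum_const, Finset.card_univ, nsmul_eq_mul]
    ring
  simp only [h3, Finset.sum_add_distrib, ← Finset.sum_mul, ← Finset.mul_sum]

/-- The spectral estimate: on functions with vanishing column sums, the quadratic form of the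
signed part of the adjacency operator is at most `q / 2` times the squared norm. -/
theorem quadraticForm_le (hF : Fintype.card F % 4 = 1) {f g : F → F → ℝ}
    (hf : ∀ x, ∑ y, f x y = 0) (hg : ∀ m, ∑ c, g m c = 0) :
    (∑ x, ∑ y, f x y * quadraticConv (f x) y) / 2
        - (∑ m, ∑ c, g m c * quadraticConv (g m) c) / 2
        + 2 * ∑ x, ∑ y, f x y * sumLinesThrough g x y
      ≤ (Fintype.card F : ℝ) / 2 * (∑ x, ∑ y, f x y ^ 2 + ∑ m, ∑ c, g m c ^ 2) := by
  have hq : (5 : ℝ) ≤ Fintype.card F := by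
    have := Fintype.one_lt_card (α := F)
    exact_mod_cast (show 5 ≤ Fintype.card F by omega)
  set q : ℝ := (Fintype.card F : ℝ) with hqdef
  -- Applied with s a value of (f, g) and t the value of M(f, g). As M² = 5q/4, the total factor is
  -- q/4 + 5/4, which is at most q/2 exactly when q ≥ 5.
  have amgm : ∀ s t : ℝ, s * t ≤ q / 4 * s ^ 2 + t ^ 2 / q := by
    intro s t
    have : q / 4 * s ^ 2 + t ^ 2 / q - s * t = (q * s / 2 - t) ^ 2 / q := by
      field_simp
      ring
    have := div_nonneg (sq_nonneg (q * s / 2 - t)) (by linarith : (0 : ℝ) ≤ q)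
    linarith
  have e1 := Finset.sum_le_sum fun x (_ : x ∈ Finset.univ) =>
    Finset.sum_le_sum fun y (_ : y ∈ Finset.univ) =>
      amgm (f x y) (quadraticConv (f x) y / 2 + sumLinesThrough g x y)
  have e2 := Finset.sum_le_sum fun m (_ : m ∈ Finset.univ) =>
    Finset.sum_le_sum fun c (_ : c ∈ Finset.univ) =>
      amgm (g m c) (sumPointsOn f m c - quadraticConv (g m) c / 2)
  have n1 : ∑ x, ∑ y, quadraticConv (f x) y ^ 2 = q * ∑ x, ∑ y, f x y ^ 2 := by
    simp only [sum_quadraticConv_sq hF (hf _), Finset.mul_sum, hqdef]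
  have n2 : ∑ m, ∑ c, quadraticConv (g m) c ^ 2 = q * ∑ m, ∑ c, g m c ^ 2 := by
    simp only [sum_quadraticConv_sq hF (hg _), Finset.mul_sum, hqdef]
  have n3 := sum_sumLinesThrough_sq hg
  have n4 := sum_sumPointsOn_sq hf
  have n5 := sum_quadraticConv_mul_sumLinesThrough hF f g
  have n6 := sum_mul_sumLinesThrough f g
  have t1 : ∑ x, ∑ y, (quadraticConv (f x) y / 2 + sumLinesThrough g x y) ^ 2
      = (∑ x, ∑ y, quadraticConv (f x) y ^ 2) / 4
        + ∑ x, ∑ y, quadraticConv (f x) y * sumLinesThrough g x y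
        + ∑ x, ∑ y, sumLinesThrough g x y ^ 2 := by
    simp only [Finset.sum_div, ← Finset.sum_add_distrib]
    exact Finset.sum_congr rfl fun x _ => Finset.sum_congr rfl fun y _ => by ring
  have t2 : ∑ m, ∑ c, (sumPointsOn f m c - quadraticConv (g m) c / 2) ^ 2
      = (∑ m, ∑ c, quadraticConv (g m) c ^ 2) / 4
        - ∑ m, ∑ c, sumPointsOn f m c * quadraticConv (g m) c
        + ∑ m, ∑ c, sumPointsOn f m c ^ 2 := by
    simp only [Finset.sum_div, ← Finset.sum_add_distrib, ← Finset.sum_sub_distrib]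
    exact Finset.sum_congr rfl fun x _ => Finset.sum_congr rfl fun y _ => by ring
  have t3 : ∑ x, ∑ y, f x y * (quadraticConv (f x) y / 2 + sumLinesThrough g x y)
      = (∑ x, ∑ y, f x y * quadraticConv (f x) y) / 2
        + ∑ x, ∑ y, f x y * sumLinesThrough g x y := by
    simp only [Finset.sum_div, ← Finset.sum_add_distrib]
    exact Finset.sum_congr rfl fun x _ => Finset.sum_congr rfl fun y _ => by ring
  have t4 : ∑ m, ∑ c, g m c * (sumPointsOn f m c - quadraticConv (g m) c / 2)
      = ∑ m, ∑ c, sumPointsOn f m c * g m c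
        - (∑ m, ∑ c, g m c * quadraticConv (g m) c) / 2 := by
    simp only [Finset.sum_div, ← Finset.sum_sub_distrib]
    exact Finset.sum_congr rfl fun x _ => Finset.sum_congr rfl fun y _ => by ring
  rw [t3] at e1
  rw [t4] at e2
  simp only [Finset.sum_add_distrib, ← Finset.mul_sum, ← Finset.sum_div] at e1 e2
  set U := ∑ x, ∑ y, f x y ^ 2
  set V := ∑ m, ∑ c, g m c ^ 2
  have hU : 0 ≤ U := Finset.sum_nonneg fun x _ => Finset.sum_nonneg fun y _ => sq_nonneg _
  have hV : 0 ≤ V := Finset.sum_nonneg fun x _ => Finset.sum_nonneg fun y _ => sq_nonneg _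
  -- The cross terms cancel by `n5`, thanks to the opposite signs of C in the two blocks.
  have hsum : (∑ x, ∑ y, (quadraticConv (f x) y / 2 + sumLinesThrough g x y) ^ 2) / q
      + (∑ m, ∑ c, (sumPointsOn f m c - quadraticConv (g m) c / 2) ^ 2) / q
      = 5 / 4 * (U + V) := by
    rw [t1, t2, n1, n2, n3, n4, n5]
    field_simp
    ring
  have : 0 ≤ (q - 5) * (U + V) := mul_nonneg (by linarith) (by linarith)
  linarith

end LineSums

/-! ### Counting crossing edges with indicators. -/

section CrossingEdges

/-- The indicator of a proposition as a real number. -/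
noncomputable def realIndicator (p : Prop) : ℝ := by
  classical exact if p then 1 else 0

theorem realIndicator_of_true {p : Prop} (h : p) : realIndicator p = 1 := if_pos h

theorem realIndicator_of_not {p : Prop} (h : ¬p) : realIndicator p = 0 := if_neg h

theorem realIndicator_mul_self (p : Prop) : realIndicator p * realIndicator p = realIndicator p := by
  by_cases h : p
  · simp [realIndicator_of_true h]
  · simp [realIndicator_of_not h]

theorem sum_realIndicator_mem {V : Type*} [Fintype V] (S : Set V) :
    ∑ u, realIndicator (u ∈ S) = S.ncard := by
  classical
  simp only [realIndicator, Finset.sum_boole, Set.ncard_eq_toFinset_card']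
  congr 2
  ext
  simp

theorem SimpleGraph.ncard_crossingEdges {V : Type*} [Fintype V] (G : SimpleGraph V) (S : Set V) :
    ((G.crossingEdges S).ncard : ℝ) = ∑ u, ∑ v, realIndicator (u ∈ S) *
      (1 - realIndicator (v ∈ S)) * realIndicator (G.Adj u v) := by
  classical
  have h1 : G.crossingEdges S
      = (fun p : V × V => s(p.1, p.2)) '' {p | p.1 ∈ S ∧ p.2 ∉ S ∧ G.Adj p.1 p.2} := by
    ext e
    constructor
    · rintro ⟨u, hu, v, hv, huv, rfl⟩
      exact ⟨(u, v), ⟨hu, hv, huv⟩, rfl⟩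
    · rintro ⟨⟨u, v⟩, ⟨hu, hv, huv⟩, rfl⟩
      exact ⟨u, hu, v, hv, huv, rfl⟩
  -- Orienting each crossing edge from `S` to its complement makes it count once.
  have h2 : Set.InjOn (fun p : V × V => s(p.1, p.2))
      {p | p.1 ∈ S ∧ p.2 ∉ S ∧ G.Adj p.1 p.2} := by
    rintro ⟨u, v⟩ ⟨hu, hv, -⟩ ⟨u', v'⟩ ⟨hu', hv', -⟩ h
    rcases Sym2.eq_iff.1 h with ⟨h1, h2⟩ | ⟨h1, h2⟩
    · exact Prod.ext h1 h2
    · dsimp only at hu hv' h1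
      exact absurd (h1 ▸ hu) hv'
  rw [h1, h2.ncard_image, ← sum_realIndicator_mem, Fintype.sum_prod_type]
  refine Finset.sum_congr rfl fun u _ => Finset.sum_congr rfl fun v _ => ?_
  by_cases hu : u ∈ S <;> by_cases hv : v ∈ S <;> by_cases ha : G.Adj u v <;>
    simp [realIndicator, hu, hv, ha]

end CrossingEdges

/-! ### Adjacency in the SlimFly graph and the cut formula. -/

theorem slimFly_adj_zero_one {F : Type*} [Field F] {ζ : F} (x y m c : F) :
    (slimFly ζ).Adj (0, x, y) (1, m, c) ↔ y = m * x + c := by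
  simp only [slimFly, SimpleGraph.fromRel_adj]
  constructor
  · rintro ⟨-, (⟨_, _, _, _, h2, _⟩ | ⟨_, _, _, h1, _⟩ | ⟨_, _, _, _, h1, h2, h3⟩) |
      (⟨_, _, _, h1, _⟩ | ⟨_, _, _, _, h2, _⟩ | ⟨_, _, _, _, h1, _⟩)⟩
    · simp at h2
    · simp at h1
    · simp only [Prod.mk.injEq, true_and] at h1 h2
      rw [h1.1, h1.2, h2.1, h2.2, h3]
    · simp at h1
    · simp at h2
    · simp at h1
  · intro h
    exact ⟨by simp, Or.inl (Or.inr (Or.inr ⟨x, y, m, c, rfl, rfl, h⟩))⟩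

section SlimFly

variable {F : Type*} [Field F] [Fintype F] {ζ : F}

theorem IsPrimitiveRoot.realQuadraticChar_eq (hF : Fintype.card F % 4 = 1)
    (hζ : IsPrimitiveRoot ζ (Fintype.card F - 1)) : realQuadraticChar F ζ = -1 := by
  classical
  have hc := Fintype.one_lt_card (α := F)
  have h0 : ζ ≠ 0 := hζ.ne_zero (by omega)
  have h : ¬IsSquare ζ := by
    rintro ⟨a, rfl⟩
    have ha : a ≠ 0 := left_ne_zero_of_mul h0
    -- A square has order dividing (q - 1)/2, too small for a primitive root.
    have h1 : (a * a) ^ ((Fintype.card F - 1) / 2) = 1 := by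
      rw [← sq, ← pow_mul, show 2 * ((Fintype.card F - 1) / 2) = Fintype.card F - 1 by omega,
        FiniteField.pow_card_sub_one_eq_one a ha]
    have := Nat.le_of_dvd (by omega) (hζ.dvd_of_pow_eq_one _ h1)
    omega
  simp only [realQuadraticChar]
  rw [quadraticChar_neg_one_iff_not_isSquare.2 h]
  simp

theorem IsPrimitiveRoot.realQuadraticChar_pow (hF : Fintype.card F % 4 = 1)
    (hζ : IsPrimitiveRoot ζ (Fintype.card F - 1)) (i : ℕ) :
    realQuadraticChar F (ζ ^ i) = (-1) ^ i := by
  induction i with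
  | zero => simp [realQuadraticChar]
  | succ i ih =>
    rw [pow_succ, pow_succ, realQuadraticChar_mul, ih, hζ.realQuadraticChar_eq hF]

theorem IsPrimitiveRoot.exists_pow_eq {z : F} (hζ : IsPrimitiveRoot ζ (Fintype.card F - 1))
    (hz : z ≠ 0) : ∃ i : ℕ, z = ζ ^ i := by
  have hc := Fintype.one_lt_card (α := F)
  have : NeZero (Fintype.card F - 1) := ⟨by omega⟩
  obtain ⟨i, -, hi⟩ := hζ.eq_pow_of_pow_eq_one (FiniteField.pow_card_sub_one_eq_one z hz)
  exact ⟨i, hi.symm⟩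

theorem IsPrimitiveRoot.exists_even_pow_iff (hF : Fintype.card F % 4 = 1)
    (hζ : IsPrimitiveRoot ζ (Fintype.card F - 1)) (z : F) :
    (∃ i : ℕ, Even i ∧ z = ζ ^ i) ↔ realQuadraticChar F z = 1 := by
  constructor
  · rintro ⟨i, hi, rfl⟩
    rw [hζ.realQuadraticChar_pow hF, hi.neg_one_pow]
  · intro h
    have hz : z ≠ 0 := by
      rintro rfl
      rw [realQuadraticChar_zero] at h
      norm_num at h
    obtain ⟨i, rfl⟩ := hζ.exists_pow_eq hz
    refine ⟨i, ?_, rfl⟩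
    by_contra hi
    rw [hζ.realQuadraticChar_pow hF, (Nat.not_even_iff_odd.1 hi).neg_one_pow] at h
    norm_num at h

theorem IsPrimitiveRoot.exists_odd_pow_iff (hF : Fintype.card F % 4 = 1)
    (hζ : IsPrimitiveRoot ζ (Fintype.card F - 1)) (z : F) :
    (∃ i : ℕ, Odd i ∧ z = ζ ^ i) ↔ realQuadraticChar F z = -1 := by
  constructor
  · rintro ⟨i, hi, rfl⟩
    rw [hζ.realQuadraticChar_pow hF, hi.neg_one_pow]
  · intro h
    have hz : z ≠ 0 := by
      rintro rfl
      rw [realQuadraticChar_zero] at h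
      norm_num at h
    obtain ⟨i, rfl⟩ := hζ.exists_pow_eq hz
    refine ⟨i, ?_, rfl⟩
    by_contra hi
    rw [hζ.realQuadraticChar_pow hF, (Nat.not_odd_iff_even.1 hi).neg_one_pow] at h
    norm_num at h

theorem slimFly_adj_zero_zero (hF : Fintype.card F % 4 = 1)
    (hζ : IsPrimitiveRoot ζ (Fintype.card F - 1)) (x y x' y' : F) :
    (slimFly ζ).Adj (0, x, y) (0, x', y') ↔ x = x' ∧ realQuadraticChar F (y - y') = 1 := by
  have h : ∀ a b : F, realQuadraticChar F (a - b) = realQuadraticChar F (b - a) := fun a b => by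
    rw [← neg_sub, realQuadraticChar_neg hF]
  simp only [slimFly, SimpleGraph.fromRel_adj]
  constructor
  · rintro ⟨-, (⟨_, _, _, h1, h2, h3⟩ | ⟨_, _, _, h1, _⟩ | ⟨_, _, _, _, _, h2, _⟩) |
      (⟨_, _, _, h1, h2, h3⟩ | ⟨_, _, _, h1, _⟩ | ⟨_, _, _, _, _, h2, _⟩)⟩
    · simp only [Prod.mk.injEq, true_and] at h1 h2
      rw [hζ.exists_even_pow_iff hF, ← h1.2, ← h2.2] at h3
      exact ⟨h1.1.trans h2.1.symm, h3⟩
    · simp at h1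
    · simp at h2
    · simp only [Prod.mk.injEq, true_and] at h1 h2
      rw [hζ.exists_even_pow_iff hF, ← h1.2, ← h2.2] at h3
      exact ⟨h2.1.trans h1.1.symm, (h _ _).trans h3⟩
    · simp at h1
    · simp at h2
  · rintro ⟨rfl, h1⟩
    refine ⟨?_, Or.inl (Or.inl ⟨x, y, y', rfl, rfl, (hζ.exists_even_pow_iff hF _).2 h1⟩)⟩
    rintro h2
    simp only [Prod.mk.injEq, true_and] at h2
    rw [h2, sub_self, realQuadraticChar_zero] at h1
    norm_num at h1

theorem slimFly_adj_one_one (hF : Fintype.card F % 4 = 1)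
    (hζ : IsPrimitiveRoot ζ (Fintype.card F - 1)) (m c m' c' : F) :
    (slimFly ζ).Adj (1, m, c) (1, m', c') ↔ m = m' ∧ realQuadraticChar F (c - c') = -1 := by
  have h : ∀ a b : F, realQuadraticChar F (a - b) = realQuadraticChar F (b - a) := fun a b => by
    rw [← neg_sub, realQuadraticChar_neg hF]
  simp only [slimFly, SimpleGraph.fromRel_adj]
  constructor
  · rintro ⟨-, (⟨_, _, _, h1, _⟩ | ⟨_, _, _, h1, h2, h3⟩ | ⟨_, _, _, _, h2, _⟩) |
      (⟨_, _, _, h1, _⟩ | ⟨_, _, _, h1, h2, h3⟩ | ⟨_, _, _, _, h2, _⟩)⟩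
    · simp at h1
    · simp only [Prod.mk.injEq, true_and] at h1 h2
      rw [hζ.exists_odd_pow_iff hF, ← h1.2, ← h2.2] at h3
      exact ⟨h1.1.trans h2.1.symm, h3⟩
    · simp at h2
    · simp at h1
    · simp only [Prod.mk.injEq, true_and] at h1 h2
      rw [hζ.exists_odd_pow_iff hF, ← h1.2, ← h2.2] at h3
      exact ⟨h2.1.trans h1.1.symm, (h _ _).trans h3⟩
    · simp at h2
  · rintro ⟨rfl, h1⟩
    refine ⟨?_, Or.inl (Or.inr (Or.inl ⟨m, c, c', rfl, rfl,
      (hζ.exists_odd_pow_iff hF _).2 h1⟩))⟩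
    rintro h2
    simp only [Prod.mk.injEq, true_and] at h2
    rw [h2, sub_self, realQuadraticChar_zero] at h1
    norm_num at h1

theorem realIndicator_realQuadraticChar_eq_one [DecidableEq F] (z : F) :
    realIndicator (realQuadraticChar F z = 1)
      = (1 - (if z = 0 then 1 else 0) + realQuadraticChar F z) / 2 := by
  split_ifs with h
  · subst h
    rw [realQuadraticChar_zero, realIndicator_of_not (by norm_num)]
    norm_num
  · rcases mul_self_eq_one_iff.1 (realQuadraticChar_mul_self h) with h1 | h1
    · rw [realIndicator_of_true h1, h1]
      norm_num
    · rw [h1, realIndicator_of_not (by norm_num)]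
      norm_num

theorem realIndicator_realQuadraticChar_eq_neg_one [DecidableEq F] (z : F) :
    realIndicator (realQuadraticChar F z = -1)
      = (1 - (if z = 0 then 1 else 0) - realQuadraticChar F z) / 2 := by
  split_ifs with h
  · subst h
    rw [realQuadraticChar_zero, realIndicator_of_not (by norm_num)]
    norm_num
  · rcases mul_self_eq_one_iff.1 (realQuadraticChar_mul_self h) with h1 | h1
    · rw [h1, realIndicator_of_not (by norm_num)]
      norm_num
    · rw [realIndicator_of_true h1, h1]
      norm_num

/-- Serves points with ε = 1 and lines with ε = -1. The δ term drops out since f(1 - f) = 0 on the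
diagonal. -/
theorem sum_cut_column (hF : Fintype.card F % 4 = 1) [DecidableEq F] {f : F → ℝ}
    (hf : ∀ y, f y * f y = f y) (ε : ℝ) :
    ∑ y, ∑ y', f y * (1 - f y')
        * ((1 - (if y - y' = 0 then 1 else 0) + ε * realQuadraticChar F (y - y')) / 2)
      = ((Fintype.card F : ℝ) * ∑ y, f y - (∑ y, f y) ^ 2
          - ε * ∑ y, f y * quadraticConv f y) / 2 := by
  have h : ∀ y, ∑ y', f y * (1 - f y')
        * ((1 - (if y - y' = 0 then 1 else 0) + ε * realQuadraticChar F (y - y')) / 2)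
      = ((Fintype.card F : ℝ) * f y - f y * ∑ y', f y'
          - ε * (f y * quadraticConv f y)) / 2 := by
    intro y
    have h1 : ∀ y', f y * (1 - f y')
        * ((1 - (if y - y' = 0 then 1 else 0) + ε * realQuadraticChar F (y - y')) / 2)
        = (f y - f y * f y'
          + ε * f y * realQuadraticChar F (y - y')
          - ε * f y * (realQuadraticChar F (y - y') * f y')) / 2 := by
      intro y'
      split_ifs with hy
      · rw [← sub_eq_zero.1 hy]
        linear_combination (1 / 2 : ℝ) * hf y
      · ring
    rw [Finset.sum_congr rfl fun y' _ => h1 y']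
    simp only [← Finset.sum_div, Finset.sum_sub_distrib, Finset.sum_add_distrib,
      ← Finset.mul_sum, sum_realQuadraticChar_sub' hF, Finset.sum_const, Finset.card_univ,
      nsmul_eq_mul, quadraticConv]
    ring
  simp only [h, ← Finset.sum_div, Finset.sum_sub_distrib, ← Finset.mul_sum, ← Finset.sum_mul]
  ring

/-- The size of a cut of the SlimFly graph, in terms of the indicator functions of its side on the
points and on the lines. -/
theorem ncard_crossingEdges_slimFly (hF : Fintype.card F % 4 = 1)
    (hζ : IsPrimitiveRoot ζ (Fintype.card F - 1)) (S : Set (Fin 2 × F × F)) {f g : F → F → ℝ}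
    (hf : ∀ x y, f x y = realIndicator ((0, x, y) ∈ S))
    (hg : ∀ m c, g m c = realIndicator ((1, m, c) ∈ S)) :
    (((slimFly ζ).crossingEdges S).ncard : ℝ)
      = ((Fintype.card F : ℝ) * ∑ x, ∑ y, f x y - ∑ x, (∑ y, f x y) ^ 2
          - ∑ x, ∑ y, f x y * quadraticConv (f x) y) / 2
        + ((Fintype.card F : ℝ) * ∑ m, ∑ c, g m c - ∑ m, (∑ c, g m c) ^ 2
          + ∑ m, ∑ c, g m c * quadraticConv (g m) c) / 2
        + (Fintype.card F : ℝ) * (∑ x, ∑ y, f x y + ∑ m, ∑ c, g m c)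
        - 2 * ∑ x, ∑ y, f x y * sumLinesThrough g x y := by
  classical
  have hff : ∀ x y, f x y * f x y = f x y := fun x y => by rw [hf, realIndicator_mul_self]
  have hgg : ∀ x y, g x y * g x y = g x y := fun x y => by rw [hg, realIndicator_mul_self]
  have and_ind : ∀ (p r : Prop), realIndicator (p ∧ r) = if p then realIndicator r else 0 := by
    intro p r
    by_cases hp : p <;> simp [hp, realIndicator]
  have h00 : ∑ x, ∑ y, ∑ x', ∑ y', f x y * (1 - f x' y')
        * realIndicator ((slimFly ζ).Adj (0, x, y) (0, x', y'))
      = ((Fintype.card F : ℝ) * ∑ x, ∑ y, f x y - ∑ x, (∑ y, f x y) ^ 2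
          - ∑ x, ∑ y, f x y * quadraticConv (f x) y) / 2 := by
    have h : ∀ x, ∑ y, ∑ x', ∑ y', f x y * (1 - f x' y')
        * realIndicator ((slimFly ζ).Adj (0, x, y) (0, x', y'))
        = ((Fintype.card F : ℝ) * ∑ y, f x y - (∑ y, f x y) ^ 2
          - 1 * ∑ y, f x y * quadraticConv (f x) y) / 2 := by
      intro x
      rw [← sum_cut_column hF (hff x)]
      refine Finset.sum_congr rfl fun y _ => ?_
      rw [Finset.sum_comm]
      refine Finset.sum_congr rfl fun y' _ => ?_
      simp [slimFly_adj_zero_zero hF hζ, and_ind, realIndicator_realQuadraticChar_eq_one]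
    simp only [h, one_mul, ← Finset.sum_div, Finset.sum_sub_distrib, ← Finset.mul_sum]
  have h11 : ∑ m, ∑ c, ∑ m', ∑ c', g m c * (1 - g m' c')
        * realIndicator ((slimFly ζ).Adj (1, m, c) (1, m', c'))
      = ((Fintype.card F : ℝ) * ∑ m, ∑ c, g m c - ∑ m, (∑ c, g m c) ^ 2
          + ∑ m, ∑ c, g m c * quadraticConv (g m) c) / 2 := by
    have h : ∀ m, ∑ c, ∑ m', ∑ c', g m c * (1 - g m' c')
        * realIndicator ((slimFly ζ).Adj (1, m, c) (1, m', c'))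
        = ((Fintype.card F : ℝ) * ∑ c, g m c - (∑ c, g m c) ^ 2
          - (-1) * ∑ c, g m c * quadraticConv (g m) c) / 2 := by
      intro m
      rw [← sum_cut_column hF (hgg m)]
      refine Finset.sum_congr rfl fun c _ => ?_
      rw [Finset.sum_comm]
      refine Finset.sum_congr rfl fun c' _ => ?_
      simp [slimFly_adj_one_one hF hζ, and_ind, realIndicator_realQuadraticChar_eq_neg_one,
        ← sub_eq_add_neg]
    simp only [h, ← Finset.sum_div, Finset.sum_sub_distrib, ← Finset.mul_sum]
    ring
  have line : ∀ (x y m : F) (p : F → ℝ),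
      ∑ c, p c * realIndicator (y = m * x + c) = p (y - m * x) := by
    intro x y m p
    have : ∀ c, y = m * x + c ↔ c = y - m * x := fun c =>
      ⟨fun h => by rw [h]; ring, fun h => by rw [h]; ring⟩
    simp [realIndicator, this]
  have h01 : ∑ x, ∑ y, ∑ m, ∑ c, f x y * (1 - g m c)
        * realIndicator ((slimFly ζ).Adj (0, x, y) (1, m, c))
      = (Fintype.card F : ℝ) * ∑ x, ∑ y, f x y
        - ∑ x, ∑ y, f x y * sumLinesThrough g x y := by
    have h : ∀ x y m, ∑ c, f x y * (1 - g m c)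
        * realIndicator ((slimFly ζ).Adj (0, x, y) (1, m, c))
        = f x y - f x y * g m (y - m * x) := by
      intro x y m
      simp only [slimFly_adj_zero_one]
      rw [line x y m fun c => f x y * (1 - g m c)]
      ring
    simp only [h, Finset.sum_sub_distrib, Finset.sum_const, Finset.card_univ, nsmul_eq_mul,
      Finset.mul_sum, sumLinesThrough]
  have h10 : ∑ m, ∑ c, ∑ x, ∑ y, g m c * (1 - f x y)
        * realIndicator ((slimFly ζ).Adj (1, m, c) (0, x, y))
      = (Fintype.card F : ℝ) * ∑ m, ∑ c, g m c
        - ∑ x, ∑ y, f x y * sumLinesThrough g x y := by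
    have h : ∀ m c x, ∑ y, g m c * (1 - f x y)
        * realIndicator ((slimFly ζ).Adj (1, m, c) (0, x, y))
        = g m c - f x (m * x + c) * g m c := by
      intro m c x
      simp only [(slimFly ζ).adj_comm (1, m, c), slimFly_adj_zero_one]
      simp only [realIndicator, mul_ite, mul_one, mul_zero, Finset.sum_ite_eq', Finset.mem_univ,
        if_true]
      ring
    rw [sum_mul_sumLinesThrough]
    simp only [h, Finset.sum_sub_distrib, Finset.sum_const, Finset.card_univ, nsmul_eq_mul,
      Finset.mul_sum, Finset.sum_mul, sumPointsOn]
  rw [SimpleGraph.ncard_crossingEdges]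
  simp only [Fintype.sum_prod_type, Fin.sum_univ_two, ← hf, ← hg, Finset.sum_add_distrib,
    h00, h11, h01, h10]
  ring

end SlimFly

/-! ### The two bounds. -/

section BisectionBandwidth

variable {F : Type*} [Field F] [Fintype F] {ζ : F}

theorem sum_mul_quadraticConv_add_const (hF : Fintype.card F % 4 = 1) (g : F → ℝ) (a : ℝ) :
    ∑ y, (g y + a) * quadraticConv (fun z => g z + a) y = ∑ y, g y * quadraticConv g y := by
  simp only [quadraticConv_add_const hF, add_mul, Finset.sum_add_distrib, ← Finset.mul_sum,
    sum_quadraticConv hF, mul_zero, add_zero]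

theorem IsBalancedSet.ncard_eq {F : Type*} [Fintype F] {S : Set (Fin 2 × F × F)} (hS : IsBalancedSet S) :
    S.ncard = Fintype.card F ^ 2 := by
  have h := Set.ncard_add_ncard_compl S
  simp only [Nat.card_eq_fintype_card, Fintype.card_prod, Fintype.card_fin] at h
  obtain ⟨h1, h2⟩ := hS
  rw [sq]
  omega

theorem sum_indicator_fibers {F : Type*} [Fintype F] (S : Set (Fin 2 × F × F)) :
    ∑ x, ∑ y, realIndicator (((0 : Fin 2), x, y) ∈ S)
      + ∑ m, ∑ c, realIndicator (((1 : Fin 2), m, c) ∈ S) = S.ncard := by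
  rw [← sum_realIndicator_mem]
  simp only [Fintype.sum_prod_type, Fin.sum_univ_two]

theorem le_ncard_crossingEdges_slimFly (hF : Fintype.card F % 4 = 1)
    (hζ : IsPrimitiveRoot ζ (Fintype.card F - 1)) {S : Set (Fin 2 × F × F)}
    (hS : IsBalancedSet S) :
    (Fintype.card F : ℝ) ^ 3 / 2 ≤ ((slimFly ζ).crossingEdges S).ncard := by
  obtain ⟨f, hf⟩ : ∃ f : F → F → ℝ, ∀ x y, f x y = realIndicator (((0 : Fin 2), x, y) ∈ S) :=
    ⟨_, fun _ _ => rfl⟩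
  obtain ⟨g, hg⟩ : ∃ g : F → F → ℝ, ∀ x y, g x y = realIndicator (((1 : Fin 2), x, y) ∈ S) :=
    ⟨_, fun _ _ => rfl⟩
  have hff : ∀ x y, f x y * f x y = f x y := fun x y => by rw [hf, realIndicator_mul_self]
  have hgg : ∀ x y, g x y * g x y = g x y := fun x y => by rw [hg, realIndicator_mul_self]
  have hN := sum_indicator_fibers S
  simp only [← hf, ← hg, hS.ncard_eq, Nat.cast_pow] at hN
  rw [ncard_crossingEdges_slimFly hF hζ S hf hg]
  have hq : (0 : ℝ) < Fintype.card F := by exact_mod_cast Fintype.card_pos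
  -- Column means are split off; idempotence makes the squared norm of the remainder linear in `h`
  -- up to the squared column sums, matching the terms of the cut formula.
  have center : ∀ h : F → F → ℝ, (∀ x y, h x y * h x y = h x y) →
      ∃ h' : F → F → ℝ, (∀ x, ∑ y, h' x y = 0) ∧
        h = (fun x y => h' x y + (∑ z, h x z) / Fintype.card F) ∧
        ∑ x, ∑ y, h' x y ^ 2
          = ∑ x, ∑ y, h x y - (∑ x, (∑ y, h x y) ^ 2) / Fintype.card F := by
    intro h hh
    refine ⟨fun x y => h x y - (∑ z, h x z) / Fintype.card F, fun x => ?_, ?_, ?_⟩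
    · simp only [Finset.sum_sub_distrib, Finset.sum_const, Finset.card_univ, nsmul_eq_mul]
      field_simp
      ring
    · simp
    · rw [Finset.sum_div, ← Finset.sum_sub_distrib]
      refine Finset.sum_congr rfl fun x _ => ?_
      simp only [sub_sq, Finset.sum_add_distrib, Finset.sum_sub_distrib, ← Finset.sum_mul,
        ← Finset.mul_sum, Finset.sum_const, Finset.card_univ, nsmul_eq_mul]
      simp only [sq (h x _), hh]
      field_simp
      ring
  obtain ⟨f', hf0, hf1, hf2⟩ := center f hff
  obtain ⟨g', hg0, hg1, hg2⟩ := center g hgg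
  have key := quadraticForm_le hF hf0 hg0
  have e1 : ∑ x, ∑ y, f x y * quadraticConv (f x) y
      = ∑ x, ∑ y, f' x y * quadraticConv (f' x) y := by
    refine Finset.sum_congr rfl fun x _ => ?_
    rw [← sum_mul_quadraticConv_add_const hF (f' x) ((∑ z, f x z) / Fintype.card F),
      ← congrFun hf1 x]
    exact Finset.sum_congr rfl fun y _ => by rw [← congrFun (congrFun hf1 x) y]
  have e2 : ∑ x, ∑ y, g x y * quadraticConv (g x) y
      = ∑ x, ∑ y, g' x y * quadraticConv (g' x) y := by
    refine Finset.sum_congr rfl fun x _ => ?_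
    rw [← sum_mul_quadraticConv_add_const hF (g' x) ((∑ z, g x z) / Fintype.card F),
      ← congrFun hg1 x]
    exact Finset.sum_congr rfl fun y _ => by rw [← congrFun (congrFun hg1 x) y]
  have e3 := sum_mul_sumLinesThrough_add_const f' g' (fun x => (∑ z, f x z) / Fintype.card F)
    (fun x => (∑ z, g x z) / Fintype.card F) hf0 hg0
  rw [← hg1] at e3
  simp only [fun x y => (congrFun (congrFun hf1 x) y).symm, ← Finset.sum_div] at e3
  rw [e1, e2, e3]
  rw [hf2, hg2] at key
  set q : ℝ := (Fintype.card F : ℝ)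
  set A := ∑ x, ∑ y, f x y
  set B := ∑ x, ∑ y, g x y
  set A2 := ∑ x, (∑ y, f x y) ^ 2
  set B2 := ∑ x, (∑ y, g x y) ^ 2
  have hA : q / 2 * (A - A2 / q + (B - B2 / q)) = (q * A - A2) / 2 + (q * B - B2) / 2 := by
    field_simp
  -- AM-GM with A + B = q²; the only place where balance enters the estimate.
  have hAB : q * (A / q) * (B / q) ≤ q ^ 3 / 4 := by
    have h1 : q * (A / q) * (B / q) = A * B / q := by field_simp
    rw [h1, div_le_iff₀ hq]
    have h2 : B = q ^ 2 - A := by linarith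
    rw [h2]
    nlinarith [sq_nonneg (q ^ 2 - 2 * A)]
  rw [hA] at key
  rw [hN]
  linarith

theorem exists_isBalancedSet_ncard_crossingEdges_slimFly (hF : Fintype.card F % 4 = 1)
    (hζ : IsPrimitiveRoot ζ (Fintype.card F - 1)) :
    ∃ S : Set (Fin 2 × F × F), IsBalancedSet S ∧
      (((slimFly ζ).crossingEdges S).ncard : ℝ)
        = Fintype.card F * ((Fintype.card F : ℝ) ^ 2 + 1) / 2 := by
  obtain ⟨A, hA⟩ : ∃ A : Set F, A.ncard = (Fintype.card F - 1) / 2 := by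
    obtain ⟨A, -, hA⟩ := Set.exists_subset_card_eq (s := (Set.univ : Set F))
      (n := (Fintype.card F - 1) / 2) (by rw [Set.ncard_univ, Nat.card_eq_fintype_card]; omega)
    exact ⟨A, hA⟩
  have hB := Set.ncard_add_ncard_compl A
  rw [Nat.card_eq_fintype_card] at hB
  have hA' : (A.ncard : ℝ) = ((Fintype.card F : ℝ) - 1) / 2 := by
    have : (Fintype.card F : ℝ) = 2 * A.ncard + 1 := by
      exact_mod_cast (show Fintype.card F = 2 * A.ncard + 1 by omega)
    rw [this]
    ring
  have hB' : (Aᶜ.ncard : ℝ) = ((Fintype.card F : ℝ) + 1) / 2 := by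
    have : (A.ncard : ℝ) + Aᶜ.ncard = Fintype.card F := by exact_mod_cast hB
    linarith
  -- Complementary column sets make `S` balanced. An abscissa x and a slope m are joined by q edges,
  -- which cross when x, m are both in A or both outside: q(|A|² + |Aᶜ|²) edges. As q is odd, the
  -- sizes (q ± 1)/2 minimise this.
  set S : Set (Fin 2 × F × F) := {v | v.1 = 0 ∧ v.2.1 ∈ A ∨ v.1 = 1 ∧ v.2.1 ∈ Aᶜ} with hSdef
  have hf : ∀ x y : F, realIndicator (x ∈ A) = realIndicator (((0 : Fin 2), x, y) ∈ S) := by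
    intro x y
    simp [hSdef]
  have hg : ∀ m c : F, realIndicator (m ∈ Aᶜ) = realIndicator (((1 : Fin 2), m, c) ∈ S) := by
    intro m c
    simp [hSdef]
  have hconst : ∀ (a : ℝ) (y : F), quadraticConv (fun _ => a) y = 0 := by
    intro a y
    have := quadraticConv_add_const hF (fun _ => 0) a y
    simpa [quadraticConv] using this
  refine ⟨S, ?_, ?_⟩
  · have h := sum_indicator_fibers S
    simp only [← hf, ← hg, Finset.sum_const, Finset.card_univ, nsmul_eq_mul, ← Finset.mul_sum,
      sum_realIndicator_mem] at h
    have h1 : S.ncard = Fintype.card F * Fintype.card F := by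
      have h2 : Fintype.card F * A.ncard + Fintype.card F * Aᶜ.ncard = S.ncard := by
        exact_mod_cast h
      rw [← h2, ← mul_add, hB]
    have h3 := Set.ncard_add_ncard_compl S
    simp only [Nat.card_eq_fintype_card, Fintype.card_prod, Fintype.card_fin] at h3
    constructor <;> omega
  · rw [ncard_crossingEdges_slimFly hF hζ S hf hg]
    simp only [hconst, sumLinesThrough, Finset.sum_const, Finset.card_univ, nsmul_eq_mul,
      ← Finset.mul_sum, ← Finset.sum_mul, sum_realIndicator_mem, mul_pow, sq (realIndicator _),
      realIndicator_mul_self, mul_zero, hA', hB']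
    ring

end BisectionBandwidth

theorem mainTheorem2 (q : ℕ) (hq : IsPrimePow q) (hq4 : q ≡ 1 [MOD 4])
    (F : Type*) [Field F] [Fintype F] (hF : Fintype.card F = q)
    (ζ : F) (hζ : IsPrimitiveRoot ζ (q - 1)) :
    ((slimFly ζ).bisectionBandwidth : ℝ) ≤ (q : ℝ) * ((q : ℝ) ^ 2 + 1) / 2 ∧
      (q : ℝ) ^ 3 / 2 ≤ ((slimFly ζ).bisectionBandwidth : ℝ) := by
  subst hF
  have hF : Fintype.card F % 4 = 1 := hq4
  obtain ⟨⟨S, hS, hcut⟩, hmin⟩ := (slimFly ζ).isLeast_bisectionBandwidth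
  constructor
  · obtain ⟨T, hT, hT'⟩ := exists_isBalancedSet_ncard_crossingEdges_slimFly hF hζ
    rw [← hT']
    exact_mod_cast hmin ⟨T, hT, rfl⟩
  · rw [← hcut]
    exact le_ncard_crossingEdges_slimFly hF hζ hS
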